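/- Let $\alpha\in(0,2\pi)$, $\omega=\mathrm{e}^{i\alpha}$, and let $F(z,\bar z)=\omega z+\sum_{2\le j+k\le 3}f_{j,k}z^j\bar z^k$ with $f_{j,k}\in\mathbb{C}$. Assume that $\omega$ is not a quadratic, cubic or fourth root of unity, that is, $\omega^2\ne1$, $\omega^3\neq 1$ and $\omega^4\ne 1$. Then, among the planar polynomial vector fields of degree at most $3$ of the form $X(z,\bar z)=i\alpha z+\sum_{2\le j+k\le 3}a_{j,k}z^j\bar z^k$, $a_{j,k}\in\mathbb{C}$, there is exactly one such that the flow $\varphi(t;z,\bar z)$ of $\dot z=X(z,\bar z)$ (with $\varphi(0;z,\bar z)=z$) satisfies $\varphi(1;z,\bar z)=F(z,\bar z)+O(|z|^4)$ as $z\to 0$. Its coefficients are $$a_{2,0}=\frac{i\alpha f_{2,0}}{\omega(\omega-1)},\qquad a_{1,1}=\frac{i\alpha f_{1,1}}{\omega-1},\qquad a_{0,2}=\frac{3i\alpha\,\omega^2 f_{0,2}}{\omega^3-1},$$ $$a_{3,0}=\frac{-i\alpha\,P_{3,0}}{\omega^2(\omega^3-1)(\omega+1)},\qquad a_{2,1}=\frac{-i\,P_{2,1}}{\omega^2(\omega^3-1)^2},$$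 $$a_{1,2}=\frac{-i\alpha\,P_{1,2}}{(\omega^3-1)(\omega+1)},\qquad a_{0,3}=\frac{-i\alpha\,\omega^2\,P_{0,3}}{(\omega^2+1)(\omega^3-1)(\omega+1)},$$ where $$P_{3,0}=\left(\overline{f_{0,2}}f_{1,1}-2f_{3,0}\right)\omega^3+2\left(\overline{f_{0,2}}f_{1,1}+f_{2,0}^2-f_{3,0}\right)\omega^2+2\left(f_{2,0}^2-f_{3,0}\right)\omega+2f_{2,0}^2,$$ \begin{align*} P_{2,1}={}&\left((i+\alpha)|f_{1,1}|^2+if_{2,1}\right)\omega^7+\left((i+2\alpha)|f_{1,1}|^2-2if_{1,1}f_{2,0}\right)\omega^6\\ &+\left((i+3\alpha)|f_{1,1}|^2+(2i+6\alpha)|f_{0,2}|^2-f_{1,1}f_{2,0}(i+\alpha)\right)\omega^5\\ &+\left((-i+2\alpha)|f_{1,1}|^2-(i+2\alpha)f_{2,0}f_{1,1}-2if_{2,1}\right)\omega^4\\ &+\left(3f_{1,1}f_{2,0}-|f_{1,1}|^2\right)(i-\alpha)\omega^3\\ &+\left(-i|f_{1,1}|^2-2i|f_{0,2}|^2+(i-2\alpha)f_{1,1}f_{2,0}\right)\omega^2\\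 &+\left(f_{2,0}f_{1,1}(i-\alpha)+if_{2,1}\right)\omega-if_{1,1}f_{2,0}, \end{align*} \begin{align*} P_{1,2}={}&f_{1,1}\overline{f_{2,0}}\,\omega^4+\left(2\overline{f_{1,1}}f_{0,2}+\overline{f_{2,0}}f_{1,1}-2f_{1,2}\right)\omega^3\\ &+\left(4\overline{f_{1,1}}f_{0,2}+\overline{f_{2,0}}f_{1,1}+4f_{0,2}f_{2,0}+f_{1,1}^2-2f_{1,2}\right)\omega^2\\ &+\left(2f_{0,2}f_{2,0}+f_{1,1}^2-2f_{1,2}\right)\omega+f_{1,1}^2, \end{align*} \begin{align*} P_{0,3}={}&2f_{0,2}\overline{f_{2,0}}\,\omega^4+4\left(f_{0,2}\overline{f_{2,0}}-f_{0,3}\right)\omega^3+\left(6f_{0,2}\overline{f_{2,0}}+3f_{0,2}f_{1,1}-4f_{0,3}\right)\omega^2\\ &+2\left(f_{0,2}f_{1,1}-2f_{0,3}\right)\omega+f_{0,2}f_{1,1}. \end{align*} -/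

import Mathlib

open Filter Topology Asymptotics
open Complex (I)
open scoped ComplexConjugate

noncomputable section

/-- The polynomial map `z ↦ l z + ∑_{2 ≤ j + k ≤ n} c_{j,k} z^j z̄^k` of the plane `ℂ = ℝ²`. -/
def planarPoly (n : ℕ) (l : ℂ) (c : ℕ → ℕ → ℂ) (z : ℂ) : ℂ :=
  l * z + ∑ m ∈ Finset.Icc 2 n,
    ∑ p ∈ Finset.HasAntidiagonal.antidiagonal m, c p.1 p.2 * z ^ p.1 * conj z ^ p.2

/-- `X` is a polynomial vector field of degree at most `n` of the form
`X(z, z̄) = i α z + ∑_{2 ≤ j + k ≤ n} a_{j,k} z^j z̄^k`. -/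
def IsPolyField (n : ℕ) (α : ℝ) (X : ℂ → ℂ) : Prop :=
  ∃ a : ℕ → ℕ → ℂ, X = planarPoly n (I * α) a

/-- `φ` is, near the origin, the flow of `ż = X(z)` up to time `1`: for every `z` close enough to
`0`, the curve `t ↦ φ t z` solves the equation on `[0, 1]` and starts at `z`. -/
def IsFlowNearZero (X : ℂ → ℂ) (φ : ℝ → ℂ → ℂ) : Prop :=
  ∀ᶠ z in 𝓝 (0 : ℂ), φ 0 z = z ∧
    IsIntegralCurveOn (fun t => φ t z) (fun _ => X) (Set.Icc 0 1)

/-- The flow `φ` of `X` is defined up to time `1` near the origin and satisfies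
`φ(1; z) = F(z) + O(n + 1)`. (For the smooth `X` considered here the flow is unique near `0`.) -/
def TimeOneMapAgrees (n : ℕ) (X F : ℂ → ℂ) : Prop :=
  ∃ φ : ℝ → ℂ → ℂ, IsFlowNearZero X φ ∧
    (fun z => φ 1 z - F z) =O[𝓝 0] (fun z : ℂ => ‖z‖ ^ (n + 1))

end

/-! In the rotating coordinate `w = exp (-iαt) z` the linear part of the field disappears, so for
small `z` the solution stays close to its initial value. Write `q`, `c` for the quadratic and cubic
parts of the field and `e = exp (iαt)`. Then `w = z + Q_t(z) + C_t(z) + O(|z|^4)`, where `Q' = e⁻¹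
q(ez, ez)` and `C' = e⁻¹ (2 q(ez, e Q) + c(ez))`. These are integrated explicitly in `flowCoeff`,
and `exists_norm_sub_planarPoly_le` bounds the error.

In `Q` and `C`, each `a_{j,k}` first enters at `z^j z̄^k`, linearly, with factor `∫₀¹ exp (i n α t)
dt`, `n = j - k - 1`. Matching the time-one map with `F` is thus a triangular system: the quadratic
coefficients are found first, and the cubic ones are then affine equations. The values of `n` are
`1, -1, -3` and `2, 0, -2, -4`. The factor is `1` for `n = 0` and otherwise a nonzero multiple of
`ω^n - 1`, so the root-of-unity hypotheses make the system uniquely solvable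
(`coeffEq_flowCoeff_iff`). That the error order sees every coefficient is `coeffEq_of_isBigO`. -/

/-! ### Bounds for the quadratic and cubic parts -/

/-- The symmetric real bilinear map whose diagonal is the quadratic part of `planarPoly n l a`. -/
noncomputable def quadForm (a : ℕ → ℕ → ℂ) (x y : ℂ) : ℂ :=
  a 2 0 * (x * y) + a 1 1 * ((x * conj y + y * conj x) / 2) + a 0 2 * (conj x * conj y)

/-- The cubic part of `planarPoly n l a`. -/
noncomputable def cubicForm (a : ℕ → ℕ → ℂ) (x : ℂ) : ℂ :=
  a 3 0 * x ^ 3 + a 2 1 * (x ^ 2 * conj x) + a 1 2 * (x * conj x ^ 2) + a 0 3 * conj x ^ 3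

lemma planarPoly_three (l : ℂ) (a : ℕ → ℕ → ℂ) (z : ℂ) :
    planarPoly 3 l a z = l * z + (quadForm a z z + cubicForm a z) := by
  have h : Finset.Icc 2 3 = ({2, 3} : Finset ℕ) := by decide
  simp [planarPoly, quadForm, cubicForm, h, Finset.Nat.antidiagonal_succ]
  ring

lemma quadForm_add (a : ℕ → ℕ → ℂ) (x h : ℂ) :
    quadForm a (x + h) (x + h) = quadForm a x x + 2 * quadForm a x h + quadForm a h h := by
  simp only [quadForm, map_add]
  ring

lemma exists_norm_quadForm_le (a : ℕ → ℕ → ℂ) :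
    ∃ K, 0 ≤ K ∧ ∀ x y, ‖quadForm a x y‖ ≤ K * (‖x‖ * ‖y‖) := by
  refine ⟨‖a 2 0‖ + ‖a 1 1‖ + ‖a 0 2‖, by positivity, fun x y => ?_⟩
  have h : ‖(x * conj y + y * conj x) / 2‖ ≤ ‖x‖ * ‖y‖ := by
    have := norm_add_le (x * conj y) (y * conj x)
    simp only [norm_mul, RCLike.norm_conj] at this
    rw [norm_div, Complex.norm_two]
    linarith
  calc ‖quadForm a x y‖ ≤ ‖a 2 0 * (x * y)‖ + ‖a 1 1 * ((x * conj y + y * conj x) / 2)‖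
        + ‖a 0 2 * (conj x * conj y)‖ := norm_add₃_le
    _ ≤ ‖a 2 0‖ * (‖x‖ * ‖y‖) + ‖a 1 1‖ * (‖x‖ * ‖y‖) + ‖a 0 2‖ * (‖x‖ * ‖y‖) := by
        simp only [norm_mul, RCLike.norm_conj] at h ⊢
        gcongr
    _ = _ := by ring

lemma exists_norm_cubicForm_sub_le (a : ℕ → ℕ → ℂ) :
    ∃ K, 0 ≤ K ∧ ∀ R x y, ‖x‖ ≤ R → ‖y‖ ≤ R →
      ‖cubicForm a x - cubicForm a y‖ ≤ K * (R ^ 2 * ‖x - y‖) := by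
  refine ⟨3 * (‖a 3 0‖ + ‖a 2 1‖ + ‖a 1 2‖ + ‖a 0 3‖), by positivity, fun R x y hx hy => ?_⟩
  have hR : 0 ≤ R := (norm_nonneg x).trans hx
  -- Telescoping for three arbitrary factors; since conjugation is an isometry, it covers all four
  -- monomials.
  have key : ∀ p q r p' q' r' : ℂ, ‖p‖ ≤ R → ‖q‖ ≤ R → ‖r‖ ≤ R → ‖p'‖ ≤ R → ‖q'‖ ≤ R → ‖r'‖ ≤ R →
      ‖p - p'‖ = ‖x - y‖ → ‖q - q'‖ = ‖x - y‖ → ‖r - r'‖ = ‖x - y‖ →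
      ‖p * q * r - p' * q' * r'‖ ≤ 3 * (R ^ 2 * ‖x - y‖) := by
    intro p q r p' q' r' hp hq hr hp' hq' hr' h1 h2 h3
    calc ‖p * q * r - p' * q' * r'‖
        = ‖(p - p') * (q * r) + p' * ((q - q') * r) + p' * (q' * (r - r'))‖ := by ring_nf
      _ ≤ ‖(p - p') * (q * r)‖ + ‖p' * ((q - q') * r)‖ + ‖p' * (q' * (r - r'))‖ := norm_add₃_le
      _ ≤ ‖x - y‖ * (R * R) + R * (‖x - y‖ * R) + R * (R * ‖x - y‖) := by
          simp only [norm_mul, h1, h2, h3]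
          gcongr
      _ = _ := by ring
  have cx : ‖conj x‖ ≤ R := by simpa using hx
  have cy : ‖conj y‖ ≤ R := by simpa using hy
  have cd : ‖conj x - conj y‖ = ‖x - y‖ := by rw [← map_sub, RCLike.norm_conj]
  have h30 := key x x x y y y hx hx hx hy hy hy rfl rfl rfl
  have h21 := key x x (conj x) y y (conj y) hx hx cx hy hy cy rfl rfl cd
  have h12 := key x (conj x) (conj x) y (conj y) (conj y) hx cx cx hy cy cy rfl cd cd
  have h03 := key (conj x) (conj x) (conj x) (conj y) (conj y) (conj y) cx cx cx cy cy cy cd cd cd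
  calc ‖cubicForm a x - cubicForm a y‖
      = ‖a 3 0 * (x * x * x - y * y * y) + a 2 1 * (x * x * conj x - y * y * conj y)
          + a 1 2 * (x * conj x * conj x - y * conj y * conj y)
          + a 0 3 * (conj x * conj x * conj x - conj y * conj y * conj y)‖ := by
        simp only [cubicForm]; ring_nf
    _ ≤ ‖a 3 0‖ * (3 * (R ^ 2 * ‖x - y‖)) + ‖a 2 1‖ * (3 * (R ^ 2 * ‖x - y‖))
          + ‖a 1 2‖ * (3 * (R ^ 2 * ‖x - y‖)) + ‖a 0 3‖ * (3 * (R ^ 2 * ‖x - y‖)) := by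
        refine norm_add₄_le.trans ?_
        simp only [norm_mul] at h30 h21 h12 h03 ⊢
        gcongr
    _ = _ := by ring

/-! ### The rotating coordinate -/

/-- The nonlinear part of `planarPoly 3 (I * α) a`, in the coordinate `exp (-I α t) z` that rotates
with the linear flow. -/
noncomputable def rotField (α : ℝ) (a : ℕ → ℕ → ℂ) (t : ℝ) (x : ℂ) : ℂ :=
  Complex.exp (-(I * α * t)) *
    (quadForm a (Complex.exp (I * α * t) * x) (Complex.exp (I * α * t) * x)
      + cubicForm a (Complex.exp (I * α * t) * x))

lemma norm_exp_I_mul_mul (α t : ℝ) : ‖Complex.exp (I * α * t)‖ = 1 := by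
  rw [show I * (α : ℂ) * t = ((α * t : ℝ) : ℂ) * I by push_cast; ring]
  exact Complex.norm_exp_ofReal_mul_I _

lemma norm_exp_neg_I_mul_mul (α t : ℝ) : ‖Complex.exp (-(I * α * t))‖ = 1 := by
  rw [Complex.exp_neg, norm_inv, norm_exp_I_mul_mul, inv_one]

lemma conj_exp_I_mul_mul (α t : ℝ) :
    conj (Complex.exp (I * α * t)) = Complex.exp (-(I * α * t)) := by
  rw [← Complex.exp_conj]
  simp

lemma exp_neg_mul_exp (x : ℂ) : Complex.exp (-x) * Complex.exp x = 1 := by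
  rw [← Complex.exp_add, neg_add_cancel, Complex.exp_zero]

lemma hasDerivAt_exp_I_mul_mul (α t : ℝ) :
    HasDerivAt (fun s : ℝ => Complex.exp (I * α * s)) (I * α * Complex.exp (I * α * t)) t := by
  have h : HasDerivAt (fun s : ℝ => I * α * (s : ℂ)) (I * α * 1) t :=
    (Complex.ofRealCLM.hasDerivAt (x := t)).const_mul (I * (α : ℂ))
  convert! h.cexp using 1
  ring

lemma hasDerivAt_exp_neg_I_mul_mul (α t : ℝ) :
    HasDerivAt (fun s : ℝ => Complex.exp (-(I * α * s)))
      (-(I * α) * Complex.exp (-(I * α * t))) t := by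
  have h : HasDerivAt (fun s : ℝ => I * α * (s : ℂ)) (I * α * 1) t :=
    (Complex.ofRealCLM.hasDerivAt (x := t)).const_mul (I * (α : ℂ))
  have h' : HasDerivAt (fun s : ℝ => -(I * α * (s : ℂ))) (-(I * α * 1)) t := h.neg
  convert! h'.cexp using 1
  ring

lemma isIntegralCurveOn_rotField {α : ℝ} {a : ℕ → ℕ → ℂ} {u : ℝ → ℂ} {s : Set ℝ}
    (hu : IsIntegralCurveOn u (fun _ => planarPoly 3 (I * α) a) s) :
    IsIntegralCurveOn (fun t => Complex.exp (-(I * α * t)) * u t) (rotField α a) s := by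
  intro t ht
  convert! (hasDerivAt_exp_neg_I_mul_mul α t).hasDerivWithinAt.mul (hu t ht) using 1
  have h : Complex.exp (I * α * t) * (Complex.exp (-(I * α * t)) * u t) = u t := by
    rw [← mul_assoc, mul_comm (Complex.exp _), exp_neg_mul_exp, one_mul]
  simp only [rotField, h, planarPoly_three]
  ring

lemma isIntegralCurveOn_planarPoly {α : ℝ} {a : ℕ → ℕ → ℂ} {w : ℝ → ℂ} {s : Set ℝ}
    (hw : IsIntegralCurveOn w (rotField α a) s) :
    IsIntegralCurveOn (fun t => Complex.exp (I * α * t) * w t)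
      (fun _ => planarPoly 3 (I * α) a) s := by
  intro t ht
  convert! (hasDerivAt_exp_I_mul_mul α t).hasDerivWithinAt.mul (hw t ht) using 1
  simp only [rotField, planarPoly_three]
  linear_combination (-(quadForm a (Complex.exp (I * α * t) * w t) (Complex.exp (I * α * t) * w t)
      + cubicForm a (Complex.exp (I * α * t) * w t))) * exp_neg_mul_exp (I * α * t)

/-- Without a linear part, the Lipschitz constant on the ball of radius `R` is `O(R)`. This
smallness gives both existence up to time `1` and the a priori bound. -/
lemma exists_norm_rotField_sub_le (α : ℝ) (a : ℕ → ℕ → ℂ) :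
    ∃ K, 0 ≤ K ∧ ∀ R t x y, R ≤ 1 → ‖x‖ ≤ R → ‖y‖ ≤ R →
      ‖rotField α a t x - rotField α a t y‖ ≤ K * (R * ‖x - y‖) := by
  obtain ⟨K, hK, hq⟩ := exists_norm_quadForm_le a
  obtain ⟨M, hM, hc⟩ := exists_norm_cubicForm_sub_le a
  refine ⟨4 * K + M, by positivity, fun R t x y hR hx hy => ?_⟩
  have h0 : 0 ≤ R := (norm_nonneg x).trans hx
  set e := Complex.exp (I * α * t)
  have he : ‖e‖ = 1 := norm_exp_I_mul_mul α t
  have hex : ∀ x : ℂ, ‖e * x‖ = ‖x‖ := fun x => by rw [norm_mul, he, one_mul]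
  have hd : ‖e * x - e * y‖ = ‖x - y‖ := by rw [← mul_sub, hex]
  have hxy : ‖x - y‖ ≤ 2 * R := (norm_sub_le x y).trans (by linarith)
  have h1 : quadForm a (e * x) (e * x) - quadForm a (e * y) (e * y)
      = 2 * quadForm a (e * y) (e * x - e * y) + quadForm a (e * x - e * y) (e * x - e * y) := by
    have := quadForm_add a (e * y) (e * x - e * y)
    rw [add_sub_cancel] at this
    linear_combination this
  have h2 := hq (e * y) (e * x - e * y)
  have h3 := hq (e * x - e * y) (e * x - e * y)
  have h4 := hc R (e * x) (e * y) (by rwa [hex]) (by rwa [hex])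
  rw [hd] at h2 h3 h4
  rw [hex] at h2
  calc ‖rotField α a t x - rotField α a t y‖
      = ‖Complex.exp (-(I * α * t)) * ((2 * quadForm a (e * y) (e * x - e * y)
          + quadForm a (e * x - e * y) (e * x - e * y))
          + (cubicForm a (e * x) - cubicForm a (e * y)))‖ := by
        rw [← h1]; simp only [rotField]; congr 1; ring
    _ ≤ 2 * (K * (‖y‖ * ‖x - y‖)) + K * (‖x - y‖ * ‖x - y‖) + M * (R ^ 2 * ‖x - y‖) := by
        rw [norm_mul, norm_exp_neg_I_mul_mul, one_mul]
        refine norm_add₃_le.trans ?_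
        rw [norm_mul, Complex.norm_two]
        gcongr
    _ ≤ 2 * (K * (R * ‖x - y‖)) + K * (2 * R * ‖x - y‖) + M * (R * ‖x - y‖) := by
        gcongr
        nlinarith
    _ = _ := by ring

/-! ### Existence up to time one and the a priori bound -/

lemma rotField_zero (α : ℝ) (a : ℕ → ℕ → ℂ) (t : ℝ) : rotField α a t 0 = 0 := by
  simp [rotField, quadForm, cubicForm]

lemma continuous_rotField (α : ℝ) (a : ℕ → ℕ → ℂ) (x : ℂ) :
    Continuous fun t => rotField α a t x := by
  have h : Continuous (starRingEnd ℂ) := Complex.continuous_conj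
  unfold rotField quadForm cubicForm
  fun_prop

lemma exists_isIntegralCurveOn_rotField (α : ℝ) (a : ℕ → ℕ → ℂ) :
    ∃ δ > 0, ∀ z : ℂ, ‖z‖ < δ →
      ∃ w : ℝ → ℂ, w 0 = z ∧ IsIntegralCurveOn w (rotField α a) (Set.Icc 0 1) := by
  obtain ⟨K, hK, hl⟩ := exists_norm_rotField_sub_le α a
  -- On the ball of radius `‖z‖` about `z` the speed is at most `K (2‖z‖)^2 ≤ ‖z‖`, so no solution
  -- leaves it before time `1`. The `2` in the denominator ensures `2‖z‖ ≤ 1`.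
  refine ⟨1 / (4 * K + 2), by positivity, fun z hz => ?_⟩
  rw [lt_div_iff₀ (by positivity)] at hz
  have hz1 : 2 * ‖z‖ ≤ 1 := by nlinarith [norm_nonneg z]
  have hball : ∀ x ∈ Metric.closedBall z ‖z‖, ‖x‖ ≤ 2 * ‖z‖ := fun x hx => by
    have h1 := norm_add_le (x - z) z
    rw [sub_add_cancel] at h1
    rw [mem_closedBall_iff_norm] at hx
    linarith
  have hPL : IsPicardLindelof (rotField α a) (tmin := 0) (tmax := 1)
      ⟨0, by simp⟩ z ‖z‖₊ 0 ‖z‖₊ ⟨K * (2 * ‖z‖), by positivity⟩ := by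
    refine ⟨fun t _ => LipschitzOnWith.of_dist_le_mul fun x hx y hy => ?_,
      fun x _ => (continuous_rotField α a x).continuousOn, fun t _ x hx => ?_, by simp⟩
    · rw [dist_eq_norm, dist_eq_norm]
      refine (hl _ t x y hz1 (hball x hx) (hball y hy)).trans (le_of_eq ?_)
      exact (mul_assoc _ _ _).symm
    · have h := hl _ t x 0 hz1 (hball x hx) (by simp)
      rw [rotField_zero, sub_zero, sub_zero] at h
      have := hball x hx
      calc _ ≤ K * (2 * ‖z‖ * ‖x‖) := h
        _ ≤ K * (2 * ‖z‖ * (2 * ‖z‖)) := by gcongr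
        _ ≤ ‖z‖ := by nlinarith [norm_nonneg z]
  exact hPL.exists_eq_forall_mem_Icc_hasDerivWithinAt₀

lemma IsIntegralCurveOn.hasDerivWithinAt_Ici {w : ℝ → ℂ} {V : ℝ → ℂ → ℂ}
    (hw : IsIntegralCurveOn w V (Set.Icc 0 1)) {t : ℝ} (ht : t ∈ Set.Ico (0 : ℝ) 1) :
    HasDerivWithinAt w (V t (w t)) (Set.Ici t) t :=
  (hw t (Set.Ico_subset_Icc_self ht)).mono_of_mem_nhdsWithin (Icc_mem_nhdsGE_of_mem ht)

lemma exists_norm_le_two_mul (α : ℝ) (a : ℕ → ℕ → ℂ) :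
    ∃ δ > 0, ∀ w : ℝ → ℂ, IsIntegralCurveOn w (rotField α a) (Set.Icc 0 1) → ‖w 0‖ < δ →
      ∀ t ∈ Set.Icc (0 : ℝ) 1, ‖w t‖ ≤ 2 * ‖w 0‖ := by
  obtain ⟨K, hK, hl⟩ := exists_norm_rotField_sub_le α a
  refine ⟨1 / (4 * K + 2), by positivity, fun w hw h0 t ht => ?_⟩
  -- The barrier `δ (1 + s)` cannot be crossed: at contact the speed is at most `4Kδ² < δ`.
  -- Strictness needs `δ > 0`, hence a `δ` above `‖w 0‖`, which may vanish; choosing `δ` close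
  -- enough to `‖w 0‖` then gives the claim.
  have key : ∀ δ : ℝ, ‖w 0‖ < δ → δ < 1 / (4 * K + 2) → ‖w t‖ ≤ 2 * δ := fun δ h1 h2 => by
    have hδ : 0 < δ := (norm_nonneg _).trans_lt h1
    rw [lt_div_iff₀ (by positivity)] at h2
    have hB : ∀ s : ℝ, HasDerivAt (fun s => δ * (1 + s)) δ s := fun s => by
      simpa using ((hasDerivAt_id s).const_add 1).const_mul δ
    have := image_norm_le_of_norm_deriv_right_lt_deriv_boundary' (f := w)
      (f' := fun s => rotField α a s (w s)) (B := fun s => δ * (1 + s)) (B' := fun _ => δ)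
      hw.continuousOn (fun s hs => hw.hasDerivWithinAt_Ici hs) (by simpa using h1.le)
      (fun s _ => (hB s).continuousAt.continuousWithinAt) (fun s _ => (hB s).hasDerivWithinAt)
      (fun s hs hs' => by
        have hle : ‖w s‖ ≤ 2 * δ := by rw [hs']; nlinarith [hs.2]
        have h := hl (2 * δ) s (w s) 0 (by nlinarith) hle (by simp; positivity)
        rw [rotField_zero, sub_zero, sub_zero] at h
        calc _ ≤ K * (2 * δ * ‖w s‖) := h
          _ ≤ K * (2 * δ * (2 * δ)) := by gcongr
          _ < δ := by nlinarith) ht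
    refine this.trans ?_
    nlinarith [ht.2]
  by_contra! hlt
  obtain ⟨δ, h1, h2⟩ := exists_between (lt_min h0 (show ‖w 0‖ < ‖w t‖ / 2 by linarith))
  have := key δ h1 (h2.trans_le (min_le_left _ _))
  have := h2.trans_le (min_le_right _ _)
  linarith

/-! ### Explicit Taylor coefficients of the flow -/

/-- For `n ≠ 0`, the primitive of `t ↦ exp (n I α t)` that vanishes at `0`. -/
noncomputable def phase (α : ℝ) (n : ℤ) (t : ℝ) : ℂ :=
  (Complex.exp (I * α * t) ^ n - 1) / (n * (I * α))

lemma phase_zero_right (α : ℝ) (n : ℤ) : phase α n 0 = 0 := by simp [phase]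

lemma hasDerivAt_phase {α : ℝ} (hα : α ≠ 0) {n : ℤ} (hn : n ≠ 0) (t : ℝ) :
    HasDerivAt (phase α n) (Complex.exp (I * α * t) ^ n) t := by
  have h1 : HasDerivAt (fun s : ℝ => n * (I * α * (s : ℂ))) (n * (I * α * 1)) t :=
    ((Complex.ofRealCLM.hasDerivAt (x := t)).const_mul (I * (α : ℂ))).const_mul (n : ℂ)
  have h2 := (h1.cexp.sub_const 1).div_const (n * (I * α))
  simp only [Complex.exp_int_mul] at h2
  have hα' : (α : ℂ) ≠ 0 := by exact_mod_cast hα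
  have hn' : (n : ℂ) ≠ 0 := by exact_mod_cast hn
  convert! h2 using 1
  field_simp [Complex.I_ne_zero]

lemma conj_phase (α : ℝ) (n : ℤ) (t : ℝ) : conj (phase α n t) = phase α (-n) t := by
  simp only [phase, map_div₀, map_sub, map_one, map_zpow₀, conj_exp_I_mul_mul, map_mul,
    Complex.conj_I, Complex.conj_ofReal, Complex.exp_neg, inv_zpow', map_intCast, Int.cast_neg]
  ring_nf

/-- The Taylor coefficients of degree `2` and `3` at the origin of the time-`t` map of
`rotField α a`. -/
noncomputable def flowCoeff (α : ℝ) (a : ℕ → ℕ → ℂ) (t : ℝ) : ℕ → ℕ → ℂ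
  | 2, 0 => a 2 0 * phase α 1 t
  | 1, 1 => a 1 1 * phase α (-1) t
  | 0, 2 => a 0 2 * phase α (-3) t
  | 3, 0 => ((2 * a 2 0 ^ 2 + a 1 1 * conj (a 0 2) / 3) / (I * α) + a 3 0) * phase α 2 t
      + -(2 * a 2 0 ^ 2 / (I * α)) * phase α 1 t
      + -(a 1 1 * conj (a 0 2) / 3 / (I * α)) * phase α (-1) t
  | 2, 1 => (2 * a 2 0 * a 1 1 / (I * α)) * phase α 1 t
      + ((a 1 1 * conj (a 1 1) + 2 * a 0 2 * conj (a 0 2) / 3 - a 2 0 * a 1 1) / (I * α)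
        + a 2 1) * t
      + -((a 2 0 * a 1 1 + a 1 1 * conj (a 1 1)) / (I * α)) * phase α (-1) t
      + -(2 * a 0 2 * conj (a 0 2) / 3 / (I * α)) * phase α (-3) t
  | 1, 2 => (2 * a 2 0 * a 0 2 / 3 / (I * α)) * phase α 1 t
      + ((a 1 1 ^ 2 + a 1 1 * conj (a 2 0)) / (I * α)) * phase α (-1) t
      + ((2 * a 0 2 * conj (a 1 1) - 2 * a 2 0 * a 0 2 / 3 - a 1 1 ^ 2
          - a 1 1 * conj (a 2 0)) / (I * α) + a 1 2) * phase α (-2) t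
      + -(2 * a 0 2 * conj (a 1 1) / (I * α)) * phase α (-3) t
  | 0, 3 => (a 1 1 * a 0 2 / 3 / (I * α)) * phase α (-1) t
      + (2 * a 0 2 * conj (a 2 0) / (I * α)) * phase α (-3) t
      + (a 0 3 - (a 1 1 * a 0 2 / 3 + 2 * a 0 2 * conj (a 2 0)) / (I * α)) * phase α (-4) t
  | _, _ => 0

lemma quadForm_flowCoeff_zero (α : ℝ) (a : ℕ → ℕ → ℂ) (z : ℂ) :
    quadForm (flowCoeff α a 0) z z = 0 := by
  simp [quadForm, flowCoeff, phase_zero_right]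

lemma cubicForm_flowCoeff_zero (α : ℝ) (a : ℕ → ℕ → ℂ) (z : ℂ) :
    cubicForm (flowCoeff α a 0) z = 0 := by
  simp [cubicForm, flowCoeff, phase_zero_right]

lemma hasDerivAt_quadForm_flowCoeff {α : ℝ} (hα : α ≠ 0) (a : ℕ → ℕ → ℂ) (z : ℂ) (t : ℝ) :
    HasDerivAt (fun s => quadForm (flowCoeff α a s) z z)
      (Complex.exp (-(I * α * t)) *
        quadForm a (Complex.exp (I * α * t) * z) (Complex.exp (I * α * t) * z)) t := by
  have h1 := hasDerivAt_phase hα (n := 1) (by norm_num) t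
  have h2 := hasDerivAt_phase hα (n := -1) (by norm_num) t
  have h3 := hasDerivAt_phase hα (n := -3) (by norm_num) t
  have h := (((h1.const_mul (a 2 0)).mul_const (z * z)).add
    ((h2.const_mul (a 1 1)).mul_const ((z * conj z + z * conj z) / 2))).add
    ((h3.const_mul (a 0 2)).mul_const (conj z * conj z))
  refine h.congr_deriv ?_
  have he := Complex.exp_ne_zero (I * α * t)
  simp only [quadForm, map_mul, conj_exp_I_mul_mul, Complex.exp_neg]
  generalize Complex.exp (I * α * t) = e at he
  simp only [zpow_neg, zpow_ofNat]
  field_simp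

/-- This is the degree-three part of the equation after substituting `z + Q_t(z)`. A product of a
phase and an exponential is a combination of exponentials, so its primitive is a combination of
phases, plus a term in `t` from the resonant monomial `z² z̄`. -/
lemma hasDerivAt_cubicForm_flowCoeff {α : ℝ} (hα : α ≠ 0) (a : ℕ → ℕ → ℂ) (z : ℂ) (t : ℝ) :
    HasDerivAt (fun s => cubicForm (flowCoeff α a s) z)
      (Complex.exp (-(I * α * t)) *
        (2 * quadForm a (Complex.exp (I * α * t) * z)
            (Complex.exp (I * α * t) * quadForm (flowCoeff α a t) z z)
          + cubicForm a (Complex.exp (I * α * t) * z))) t := by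
  have p2 := hasDerivAt_phase hα (n := 2) (by norm_num) t
  have p1 := hasDerivAt_phase hα (n := 1) (by norm_num) t
  have p0 : HasDerivAt (fun s : ℝ => (s : ℂ)) 1 t := Complex.ofRealCLM.hasDerivAt (x := t)
  have m1 := hasDerivAt_phase hα (n := -1) (by norm_num) t
  have m2 := hasDerivAt_phase hα (n := -2) (by norm_num) t
  have m3 := hasDerivAt_phase hα (n := -3) (by norm_num) t
  have m4 := hasDerivAt_phase hα (n := -4) (by norm_num) t
  have g30 := ((p2.const_mul ((2 * a 2 0 ^ 2 + a 1 1 * conj (a 0 2) / 3) / (I * α) + a 3 0)).add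
    (p1.const_mul (-(2 * a 2 0 ^ 2 / (I * α))))).add
    (m1.const_mul (-(a 1 1 * conj (a 0 2) / 3 / (I * α))))
  have g21 := (((p1.const_mul (2 * a 2 0 * a 1 1 / (I * α))).add
    (p0.const_mul ((a 1 1 * conj (a 1 1) + 2 * a 0 2 * conj (a 0 2) / 3 - a 2 0 * a 1 1) / (I * α)
        + a 2 1))).add
    (m1.const_mul (-((a 2 0 * a 1 1 + a 1 1 * conj (a 1 1)) / (I * α))))).add
    (m3.const_mul (-(2 * a 0 2 * conj (a 0 2) / 3 / (I * α))))
  have g12 := (((p1.const_mul (2 * a 2 0 * a 0 2 / 3 / (I * α))).add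
    (m1.const_mul ((a 1 1 ^ 2 + a 1 1 * conj (a 2 0)) / (I * α)))).add
    (m2.const_mul ((2 * a 0 2 * conj (a 1 1) - 2 * a 2 0 * a 0 2 / 3 - a 1 1 ^ 2
          - a 1 1 * conj (a 2 0)) / (I * α) + a 1 2))).add
    (m3.const_mul (-(2 * a 0 2 * conj (a 1 1) / (I * α))))
  have g03 := ((m1.const_mul (a 1 1 * a 0 2 / 3 / (I * α))).add
    (m3.const_mul (2 * a 0 2 * conj (a 2 0) / (I * α)))).add
    (m4.const_mul (a 0 3 - (a 1 1 * a 0 2 / 3 + 2 * a 0 2 * conj (a 2 0)) / (I * α)))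
  have h := (((g30.mul_const (z ^ 3)).add (g21.mul_const (z ^ 2 * conj z))).add
    (g12.mul_const (z * conj z ^ 2))).add (g03.mul_const (conj z ^ 3))
  refine h.congr_deriv ?_
  have he := Complex.exp_ne_zero (I * α * t)
  have hα' : (α : ℂ) ≠ 0 := by exact_mod_cast hα
  have hs : I * (α : ℂ) ≠ 0 := mul_ne_zero Complex.I_ne_zero hα'
  simp only [quadForm, cubicForm, flowCoeff, map_mul, map_add, map_div₀, map_ofNat,
    Complex.conj_conj, conj_phase, conj_exp_I_mul_mul, Complex.exp_neg]
  simp only [phase, neg_neg]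
  generalize Complex.exp (I * α * t) = e at he
  generalize I * (α : ℂ) = s at hs
  simp only [zpow_neg, zpow_ofNat, Int.cast_neg, Int.cast_one, Int.cast_ofNat]
  field_simp
  ring

/-! ### The fourth-order remainder -/

/-- A bootstrap: each bound on the current error, inserted in the equation and integrated over `[0,
1]`, gains one power of `r = ‖w 0‖`. The successive bounds are `‖w‖ ≤ 2r`, then `K₁ r²`, `K₂ r³` and
finally the constant times `r⁴`. -/
lemma exists_norm_sub_planarPoly_le {α : ℝ} (hα : α ≠ 0) (a : ℕ → ℕ → ℂ) :
    ∃ K, ∃ δ > 0, ∀ w : ℝ → ℂ, IsIntegralCurveOn w (rotField α a) (Set.Icc 0 1) → ‖w 0‖ < δ →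
      ‖w 1 - planarPoly 3 1 (flowCoeff α a 1) (w 0)‖ ≤ K * ‖w 0‖ ^ 4 := by
  obtain ⟨Q, hQ, hq⟩ := exists_norm_quadForm_le a
  obtain ⟨M, hM, hc⟩ := exists_norm_cubicForm_sub_le a
  obtain ⟨δ, hδ, hw2⟩ := exists_norm_le_two_mul α a
  set K₁ := 4 * Q + 8 * M
  set K₂ := 2 * Q * K₁ + Q * K₁ ^ 2 + 8 * M
  have hK₁ : 0 ≤ K₁ := by positivity
  have hK₂ : 0 ≤ K₂ := by positivity
  refine ⟨2 * Q * K₂ + Q * K₁ ^ 2 + 4 * M * K₁, min δ 1, by positivity, fun w hw h0 => ?_⟩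
  set z := w 0
  set r := ‖z‖
  have hr : 0 ≤ r := norm_nonneg z
  have hr1 : r ≤ 1 := h0.le.trans (min_le_right _ _)
  have hwr : ∀ t ∈ Set.Icc (0 : ℝ) 1, ‖w t‖ ≤ 2 * r :=
    hw2 w hw (h0.trans_le (min_le_left _ _))
  have hex : ∀ (t : ℝ) (x : ℂ), ‖Complex.exp (I * α * t) * x‖ = ‖x‖ := fun t x => by
    rw [norm_mul, norm_exp_I_mul_mul, one_mul]
  have hen : ∀ (t : ℝ) (x : ℂ), ‖Complex.exp (-(I * α * t)) * x‖ = ‖x‖ := fun t x => by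
    rw [norm_mul, norm_exp_neg_I_mul_mul, one_mul]
  have hcub : ∀ t ∈ Set.Icc (0 : ℝ) 1,
      ‖cubicForm a (Complex.exp (I * α * t) * w t)‖ ≤ 8 * M * r ^ 3 := by
    intro t ht
    have h := hc (2 * r) (Complex.exp (I * α * t) * w t) 0 (by rw [hex]; exact hwr t ht)
      (by simp; positivity)
    rw [sub_zero, hex, show cubicForm a 0 = 0 by simp [cubicForm], sub_zero] at h
    calc _ ≤ M * ((2 * r) ^ 2 * ‖w t‖) := h
      _ ≤ M * ((2 * r) ^ 2 * (2 * r)) := by gcongr; exact hwr t ht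
      _ = _ := by ring
  have h1 : ∀ t ∈ Set.Icc (0 : ℝ) 1, ‖w t - z‖ ≤ K₁ * r ^ 2 := by
    intro t ht
    refine (norm_image_sub_le_of_norm_deriv_le_segment' hw (C := K₁ * r ^ 2) (fun s hs => ?_)
      t ht).trans (mul_le_of_le_one_right (by positivity) (by linarith [ht.2]))
    have hs' := Set.Ico_subset_Icc_self hs
    have hqs := hq (Complex.exp (I * α * s) * w s) (Complex.exp (I * α * s) * w s)
    rw [hex] at hqs
    rw [rotField, hen]
    calc _ ≤ Q * (‖w s‖ * ‖w s‖) + 8 * M * r ^ 3 :=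
          (norm_add_le _ _).trans (add_le_add hqs (hcub s hs'))
      _ ≤ Q * ((2 * r) * (2 * r)) + 8 * M * r ^ 2 := by
          have := hwr s hs'
          have : r ^ 3 ≤ r ^ 2 := pow_le_pow_of_le_one hr hr1 (by norm_num)
          gcongr
      _ = K₁ * r ^ 2 := by ring
  have expand : ∀ t : ℝ, quadForm a (Complex.exp (I * α * t) * w t) (Complex.exp (I * α * t) * w t)
      = quadForm a (Complex.exp (I * α * t) * z) (Complex.exp (I * α * t) * z)
        + 2 * quadForm a (Complex.exp (I * α * t) * z) (Complex.exp (I * α * t) * (w t - z))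
        + quadForm a (Complex.exp (I * α * t) * (w t - z))
            (Complex.exp (I * α * t) * (w t - z)) := fun t => by
    rw [← quadForm_add, ← mul_add, add_sub_cancel]
  have hq2 : ∀ t ∈ Set.Icc (0 : ℝ) 1, ‖quadForm a (Complex.exp (I * α * t) * (w t - z))
      (Complex.exp (I * α * t) * (w t - z))‖ ≤ Q * K₁ ^ 2 * r ^ 4 := by
    intro t ht
    refine (hq _ _).trans ?_
    rw [hex]
    calc _ ≤ Q * ((K₁ * r ^ 2) * (K₁ * r ^ 2)) := by gcongr <;> exact h1 t ht
      _ = _ := by ring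
  have h2 : ∀ t ∈ Set.Icc (0 : ℝ) 1,
      ‖w t - z - quadForm (flowCoeff α a t) z z‖ ≤ K₂ * r ^ 3 := by
    intro t ht
    have hd : ∀ s ∈ Set.Icc (0 : ℝ) 1, HasDerivWithinAt
        (fun s => w s - z - quadForm (flowCoeff α a s) z z)
        (rotField α a s (w s) - Complex.exp (-(I * α * s)) *
          quadForm a (Complex.exp (I * α * s) * z) (Complex.exp (I * α * s) * z))
        (Set.Icc 0 1) s := fun s hs =>
      ((hw s hs).sub_const z).sub (hasDerivAt_quadForm_flowCoeff hα a z s).hasDerivWithinAt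
    have h := norm_image_sub_le_of_norm_deriv_le_segment' hd (C := K₂ * r ^ 3) (fun s hs => ?_) t ht
    · rw [quadForm_flowCoeff_zero, sub_zero, sub_zero, show w 0 - z = 0 from sub_self _,
        sub_zero] at h
      exact h.trans (mul_le_of_le_one_right (by positivity) (by linarith [ht.2]))
    have hs' := Set.Ico_subset_Icc_self hs
    have hqs := hq (Complex.exp (I * α * s) * z) (Complex.exp (I * α * s) * (w s - z))
    rw [hex, hex] at hqs
    rw [rotField, ← mul_sub, hen, expand]
    rw [show ∀ x y v c : ℂ, x + y + v + c - x = y + v + c by intros; ring]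
    calc _ ≤ 2 * (Q * (r * (K₁ * r ^ 2))) + Q * K₁ ^ 2 * r ^ 4 + 8 * M * r ^ 3 := by
          refine norm_add₃_le.trans (add_le_add (add_le_add ?_ (hq2 s hs')) (hcub s hs'))
          rw [norm_mul, Complex.norm_two]
          have := h1 s hs'
          refine mul_le_mul_of_nonneg_left (hqs.trans ?_) zero_le_two
          gcongr
      _ ≤ 2 * (Q * (r * (K₁ * r ^ 2))) + Q * K₁ ^ 2 * r ^ 3 + 8 * M * r ^ 3 := by
          have : r ^ 4 ≤ r ^ 3 := pow_le_pow_of_le_one hr hr1 (by norm_num)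
          gcongr
      _ = K₂ * r ^ 3 := by ring
  have hd : ∀ s ∈ Set.Icc (0 : ℝ) 1, HasDerivWithinAt
      (fun s => w s - z - quadForm (flowCoeff α a s) z z - cubicForm (flowCoeff α a s) z)
      (rotField α a s (w s) - Complex.exp (-(I * α * s)) *
          quadForm a (Complex.exp (I * α * s) * z) (Complex.exp (I * α * s) * z)
        - Complex.exp (-(I * α * s)) * (2 * quadForm a (Complex.exp (I * α * s) * z)
            (Complex.exp (I * α * s) * quadForm (flowCoeff α a s) z z)
          + cubicForm a (Complex.exp (I * α * s) * z)))
      (Set.Icc 0 1) s := fun s hs =>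
    (((hw s hs).sub_const z).sub (hasDerivAt_quadForm_flowCoeff hα a z s).hasDerivWithinAt).sub
      (hasDerivAt_cubicForm_flowCoeff hα a z s).hasDerivWithinAt
  have h := norm_image_sub_le_of_norm_deriv_le_segment_01' hd
    (C := (2 * Q * K₂ + Q * K₁ ^ 2 + 4 * M * K₁) * r ^ 4) (fun s hs => ?_)
  · rw [quadForm_flowCoeff_zero, cubicForm_flowCoeff_zero, show w 0 - z = 0 from sub_self _] at h
    rw [planarPoly_three]
    convert! h using 2
    ring
  have hs' := Set.Ico_subset_Icc_self hs
  have hqs := hq (Complex.exp (I * α * s) * z)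
    (Complex.exp (I * α * s) * (w s - z - quadForm (flowCoeff α a s) z z))
  have hcs := hc (2 * r) (Complex.exp (I * α * s) * w s) (Complex.exp (I * α * s) * z)
    (by rw [hex]; exact hwr s hs') (by rw [hex]; linarith)
  rw [← mul_sub, hex] at hcs
  rw [hex, hex] at hqs
  -- Additivity in the second slot isolates `q(ez, e Q)`, which cancels against `C'`; what remains
  -- involves only the third-order error.
  have hlin : ∀ x y v : ℂ, quadForm a x (y * v)
      = quadForm a x (y * (v - quadForm (flowCoeff α a s) z z))
      + quadForm a x (y * quadForm (flowCoeff α a s) z z) := fun x y v => by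
    simp only [quadForm, map_mul, map_sub]; ring
  rw [rotField, ← mul_sub, ← mul_sub, hen, expand, hlin _ _ (w s - z)]
  rw [show ∀ x y y' v c c' : ℂ, x + 2 * (y + y') + v + c - x - (2 * y' + c')
    = 2 * y + v + (c - c') by intros; ring]
  calc _ ≤ 2 * (Q * (r * (K₂ * r ^ 3))) + Q * K₁ ^ 2 * r ^ 4
          + M * ((2 * r) ^ 2 * (K₁ * r ^ 2)) := by
        refine norm_add₃_le.trans (add_le_add (add_le_add ?_ (hq2 s hs')) (hcs.trans ?_))
        · rw [norm_mul, Complex.norm_two]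
          have := h2 s hs'
          refine mul_le_mul_of_nonneg_left (hqs.trans ?_) zero_le_two
          gcongr
        · have := h1 s hs'
          gcongr
    _ = _ := by ring

/-! ### From the remainder to the time-one map -/

lemma IsFlowNearZero.isBigO_sub {α : ℝ} (hα : α ≠ 0) {a : ℕ → ℕ → ℂ} {φ : ℝ → ℂ → ℂ}
    (hφ : IsFlowNearZero (planarPoly 3 (I * α) a) φ) :
    (fun z => φ 1 z - Complex.exp (I * α) * planarPoly 3 1 (flowCoeff α a 1) z)
      =O[𝓝 0] fun z : ℂ => ‖z‖ ^ 4 := by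
  obtain ⟨K, δ, hδ, h⟩ := exists_norm_sub_planarPoly_le hα a
  refine IsBigO.of_bound K ?_
  filter_upwards [hφ, Metric.ball_mem_nhds (0 : ℂ) hδ] with z ⟨hz0, hz⟩ hzδ
  have hw0 : Complex.exp (-(I * α * (0 : ℝ))) * φ 0 z = z := by simp [hz0]
  have := h _ (isIntegralCurveOn_rotField hz)
    (by rw [hw0]; exact mem_ball_zero_iff.1 hzδ)
  rw [hw0, Complex.ofReal_one, mul_one] at this
  have he : φ 1 z = Complex.exp (I * α) * (Complex.exp (-(I * α)) * φ 1 z) := by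
    rw [← mul_assoc, mul_comm (Complex.exp _), exp_neg_mul_exp, one_mul]
  have hn : ‖Complex.exp (I * α)‖ = 1 := by simp [mul_comm I, Complex.norm_exp_ofReal_mul_I]
  rw [he, ← mul_sub, norm_mul, hn, one_mul]
  simpa using this

lemma exists_isFlowNearZero (α : ℝ) (a : ℕ → ℕ → ℂ) :
    ∃ φ, IsFlowNearZero (planarPoly 3 (I * α) a) φ := by
  obtain ⟨δ, hδ, h⟩ := exists_isIntegralCurveOn_rotField α a
  choose! w hw0 hw using h
  refine ⟨fun t z => Complex.exp (I * α * t) * w z t, ?_⟩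
  filter_upwards [Metric.ball_mem_nhds (0 : ℂ) hδ] with z hz
  rw [mem_ball_zero_iff] at hz
  exact ⟨by simp [hw0 z hz], isIntegralCurveOn_planarPoly (hw z hz)⟩

/-- All flows of the field share the same third-order expansion at time `1`, and one exists, so the
condition no longer depends on `φ`. -/
lemma timeOneMapAgrees_iff_isBigO {α : ℝ} (hα : α ≠ 0) (a : ℕ → ℕ → ℂ) (F : ℂ → ℂ) :
    TimeOneMapAgrees 3 (planarPoly 3 (I * α) a) F ↔
      (fun z => Complex.exp (I * α) * planarPoly 3 1 (flowCoeff α a 1) z - F z)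
        =O[𝓝 0] fun z : ℂ => ‖z‖ ^ 4 := by
  refine ⟨fun ⟨φ, hφ, h⟩ => ?_, fun h => ?_⟩
  · simpa using h.sub (hφ.isBigO_sub hα)
  · obtain ⟨φ, hφ⟩ := exists_isFlowNearZero α a
    exact ⟨φ, hφ, by simpa using (hφ.isBigO_sub hα).add h⟩

/-! ### Recovering coefficients from the asymptotics -/

/-- Equality of all coefficients of degree `2` and `3`. -/
def CoeffEq (a b : ℕ → ℕ → ℂ) : Prop :=
  (a 2 0 = b 2 0 ∧ a 1 1 = b 1 1 ∧ a 0 2 = b 0 2) ∧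
    a 3 0 = b 3 0 ∧ a 2 1 = b 2 1 ∧ a 1 2 = b 1 2 ∧ a 0 3 = b 0 3

lemma CoeffEq.planarPoly_eq {a b : ℕ → ℕ → ℂ} (h : CoeffEq a b) (l : ℂ) :
    planarPoly 3 l a = planarPoly 3 l b := by
  obtain ⟨⟨h20, h11, h02⟩, h30, h21, h12, h03⟩ := h
  funext z
  simp only [planarPoly_three, quadForm, cubicForm, h20, h11, h02, h30, h21, h12, h03]

lemma eq_zero_of_isBigO {q c : ℂ}
    (h : (fun s : ℝ => (s : ℂ) ^ 2 * q + (s : ℂ) ^ 3 * c) =O[𝓝[>] 0] fun s : ℝ => s ^ 4) :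
    q = 0 ∧ c = 0 := by
  have hid : Tendsto (fun s : ℝ => (s : ℂ)) (𝓝[>] 0) (𝓝 0) := by
    have : Tendsto (fun s : ℝ => (s : ℂ)) (𝓝 0) (𝓝 ((0 : ℝ) : ℂ)) :=
      Complex.continuous_ofReal.tendsto 0
    simpa using this.mono_left nhdsWithin_le_nhds
  obtain ⟨K, hK⟩ := h.bound
  have hq : q = 0 := by
    have h1 : Tendsto (fun s : ℝ => q + s * c) (𝓝[>] 0) (𝓝 (q + 0 * c)) :=
      (hid.mul_const c).const_add q
    have h2 : Tendsto (fun s : ℝ => q + s * c) (𝓝[>] 0) (𝓝 0) := by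
      refine squeeze_zero_norm' (a := fun s : ℝ => K * ‖(s : ℂ)‖ ^ 2) ?_ ?_
      · filter_upwards [hK, self_mem_nhdsWithin] with s hs (hs0 : 0 < s)
        rw [show (s : ℂ) ^ 2 * q + (s : ℂ) ^ 3 * c = (s : ℂ) ^ 2 * (q + s * c) by ring,
          norm_mul, norm_pow, norm_pow, Complex.norm_real, Real.norm_of_nonneg hs0.le] at hs
        rw [Complex.norm_real, Real.norm_of_nonneg hs0.le]
        refine le_of_mul_le_mul_left (hs.trans_eq ?_) (pow_pos hs0 2)
        ring
      · simpa using (hid.norm.pow 2).const_mul K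
    simpa using tendsto_nhds_unique h1 h2
  refine ⟨hq, ?_⟩
  have h2 : Tendsto (fun _ : ℝ => c) (𝓝[>] 0) (𝓝 0) := by
    refine squeeze_zero_norm' (a := fun s : ℝ => K * ‖(s : ℂ)‖) ?_ ?_
    · filter_upwards [hK, self_mem_nhdsWithin] with s hs (hs0 : 0 < s)
      rw [hq, mul_zero, zero_add, norm_mul, norm_pow, norm_pow, Complex.norm_real,
        Real.norm_of_nonneg hs0.le] at hs
      rw [Complex.norm_real, Real.norm_of_nonneg hs0.le]
      refine le_of_mul_le_mul_left (hs.trans_eq ?_) (pow_pos hs0 3)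
      ring
    · simpa using hid.norm.const_mul K
  exact tendsto_nhds_unique tendsto_const_nhds h2

/-- Along each ray `s u` the homogeneous parts must vanish separately. The values at `u = 1, I, 1 +
I`, and also `1 - I` for the cubic part, determine all coefficients. -/
lemma coeffEq_of_isBigO {l : ℂ} {a b : ℕ → ℕ → ℂ}
    (h : (fun z => planarPoly 3 l a z - planarPoly 3 l b z) =O[𝓝 0] fun z : ℂ => ‖z‖ ^ 4) :
    CoeffEq a b := by
  have key : ∀ u : ℂ, quadForm a u u - quadForm b u u = 0 ∧ cubicForm a u - cubicForm b u = 0 := by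
    intro u
    have hid : Tendsto (fun s : ℝ => (s : ℂ) * u) (𝓝[>] 0) (𝓝 0) := by
      have : Tendsto (fun s : ℝ => (s : ℂ) * u) (𝓝 0) (𝓝 (((0 : ℝ) : ℂ) * u)) :=
        (Complex.continuous_ofReal.mul continuous_const).tendsto 0
      simpa using this.mono_left nhdsWithin_le_nhds
    refine eq_zero_of_isBigO (((h.comp_tendsto hid).congr_left fun s => ?_).trans
      (IsBigO.of_bound (‖u‖ ^ 4) (Eventually.of_forall fun s => le_of_eq ?_)))
    · simp only [Function.comp_apply, planarPoly_three, quadForm, cubicForm, map_mul,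
        Complex.conj_ofReal]
      ring
    · simp [mul_pow, mul_comm]
  have hI := Complex.I_mul_I
  have q1 := (key 1).1
  have q2 := (key I).1
  have q3 := (key (1 + I)).1
  have c1 := (key 1).2
  have c2 := (key I).2
  have c3 := (key (1 + I)).2
  have c4 := (key (1 - I)).2
  simp only [quadForm, cubicForm, map_one, map_add, map_sub, Complex.conj_I] at q1 q2 q3 c1 c2 c3 c4
  have hq1 : (a 2 0 - b 2 0) + (a 1 1 - b 1 1) + (a 0 2 - b 0 2) = 0 := by linear_combination q1
  have hq2 : -(a 2 0 - b 2 0) + (a 1 1 - b 1 1) - (a 0 2 - b 0 2) = 0 := by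
    linear_combination q2 - ((a 2 0 - b 2 0) - (a 1 1 - b 1 1) + (a 0 2 - b 0 2)) * hI
  have hq3 : I * ((a 2 0 - b 2 0) - (a 0 2 - b 0 2)) = I * -(a 1 1 - b 1 1) * -I := by
    linear_combination q3 / 2
      - ((a 2 0 - b 2 0) - (a 1 1 - b 1 1) + (a 0 2 - b 0 2)) / 2 * hI - (a 1 1 - b 1 1) * hI
  have hc1 : (a 3 0 - b 3 0) + (a 2 1 - b 2 1) + (a 1 2 - b 1 2) + (a 0 3 - b 0 3) = 0 := by
    linear_combination c1
  have hc2 : (a 3 0 - b 3 0) - (a 2 1 - b 2 1) + (a 1 2 - b 1 2) - (a 0 3 - b 0 3) = 0 := by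
    linear_combination I * c2 - ((a 3 0 - b 3 0) - (a 2 1 - b 2 1) + (a 1 2 - b 1 2)
      - (a 0 3 - b 0 3)) * (I * I - 1) * hI
  have hc3 : -(a 3 0 - b 3 0) + (a 2 1 - b 2 1) + (a 1 2 - b 1 2) - (a 0 3 - b 0 3) = 0 := by
    linear_combination (c3 + c4) / 4 - (3 * (a 3 0 - b 3 0) - (a 2 1 - b 2 1) - (a 1 2 - b 1 2)
      + 3 * (a 0 3 - b 0 3)) / 2 * hI
  have hc4 : I * ((a 3 0 - b 3 0) + (a 2 1 - b 2 1) - (a 1 2 - b 1 2) - (a 0 3 - b 0 3))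
      = I * 0 := by
    linear_combination (c3 - c4) / 4 - ((a 3 0 - b 3 0) - (a 2 1 - b 2 1) + (a 1 2 - b 1 2)
      - (a 0 3 - b 0 3)) * I / 2 * hI
  replace hc4 := mul_left_cancel₀ Complex.I_ne_zero hc4
  have h11 : a 1 1 - b 1 1 = 0 := by linear_combination (hq1 + hq2) / 2
  rw [h11, neg_zero, mul_zero, zero_mul] at hq3
  replace hq3 := (mul_eq_zero.1 hq3).resolve_left Complex.I_ne_zero
  refine ⟨⟨?_, sub_eq_zero.1 h11, ?_⟩, ?_, ?_, ?_, ?_⟩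
  · linear_combination (hq1 - h11 + hq3) / 2
  · linear_combination (hq1 - h11 - hq3) / 2
  · linear_combination (hc1 + hc2 - hc3 + hc4) / 4
  · linear_combination (hc1 - hc2 + hc3 + hc4) / 4
  · linear_combination (hc1 + hc2 + hc3 - hc4) / 4
  · linear_combination (hc1 - hc2 - hc3 - hc4) / 4

/-! ### Solving the triangular system -/

/-- The coefficients of the polynomial field whose time-one map is `planarPoly 3 ω f` to order `3`. -/
noncomputable def fieldCoeff (α : ℝ) (ω : ℂ) (f : ℕ → ℕ → ℂ) : ℕ → ℕ → ℂ
  | 2, 0 => I * α * f 2 0 / (ω * (ω - 1))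
  | 1, 1 => I * α * f 1 1 / (ω - 1)
  | 0, 2 => 3 * I * α * ω ^ 2 * f 0 2 / (ω ^ 3 - 1)
  | 3, 0 => -I * α *
        ((conj (f 0 2) * f 1 1 - 2 * f 3 0) * ω ^ 3
          + 2 * (conj (f 0 2) * f 1 1 + f 2 0 ^ 2 - f 3 0) * ω ^ 2
          + 2 * (f 2 0 ^ 2 - f 3 0) * ω
          + 2 * f 2 0 ^ 2)
        / (ω ^ 2 * (ω ^ 3 - 1) * (ω + 1))
  | 2, 1 => -I *
        (((I + α) * (‖f 1 1‖ : ℂ) ^ 2 + I * f 2 1) * ω ^ 7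
          + ((I + 2 * α) * (‖f 1 1‖ : ℂ) ^ 2 - 2 * I * f 1 1 * f 2 0) * ω ^ 6
          + ((I + 3 * α) * (‖f 1 1‖ : ℂ) ^ 2 + (2 * I + 6 * α) * (‖f 0 2‖ : ℂ) ^ 2
              - f 1 1 * f 2 0 * (I + α)) * ω ^ 5
          + ((-I + 2 * α) * (‖f 1 1‖ : ℂ) ^ 2 - (I + 2 * α) * f 2 0 * f 1 1
              - 2 * I * f 2 1) * ω ^ 4
          + (3 * f 1 1 * f 2 0 - (‖f 1 1‖ : ℂ) ^ 2) * (I - α) * ω ^ 3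
          + (-I * (‖f 1 1‖ : ℂ) ^ 2 - 2 * I * (‖f 0 2‖ : ℂ) ^ 2
              + (I - 2 * α) * f 1 1 * f 2 0) * ω ^ 2
          + (f 2 0 * f 1 1 * (I - α) + I * f 2 1) * ω
          - I * f 1 1 * f 2 0)
        / (ω ^ 2 * (ω ^ 3 - 1) ^ 2)
  | 1, 2 => -I * α *
        (f 1 1 * conj (f 2 0) * ω ^ 4
          + (2 * conj (f 1 1) * f 0 2 + conj (f 2 0) * f 1 1 - 2 * f 1 2) * ω ^ 3
          + (4 * conj (f 1 1) * f 0 2 + conj (f 2 0) * f 1 1 + 4 * f 0 2 * f 2 0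
              + f 1 1 ^ 2 - 2 * f 1 2) * ω ^ 2
          + (2 * f 0 2 * f 2 0 + f 1 1 ^ 2 - 2 * f 1 2) * ω
          + f 1 1 ^ 2)
        / ((ω ^ 3 - 1) * (ω + 1))
  | 0, 3 => -I * α * ω ^ 2 *
        (2 * f 0 2 * conj (f 2 0) * ω ^ 4
          + 4 * (f 0 2 * conj (f 2 0) - f 0 3) * ω ^ 3
          + (6 * f 0 2 * conj (f 2 0) + 3 * f 0 2 * f 1 1 - 4 * f 0 3) * ω ^ 2
          + 2 * (f 0 2 * f 1 1 - 2 * f 0 3) * ω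
          + f 0 2 * f 1 1)
        / ((ω ^ 2 + 1) * (ω ^ 3 - 1) * (ω + 1))
  | _, _ => 0

lemma phase_one (α : ℝ) (n : ℤ) :
    phase α n 1 = (Complex.exp (I * α) ^ n - 1) / (n * (I * α)) := by
  simp [phase]

/-- Absorbing `-I` leaves `I` and `α` only in the product `I * α`, which can then be treated as an
indeterminate. -/
lemma fieldCoeff_two_one (α : ℝ) (ω : ℂ) (f : ℕ → ℕ → ℂ) :
    fieldCoeff α ω f 2 1 =
      (((1 - I * α) * (f 1 1 * conj (f 1 1)) + f 2 1) * ω ^ 7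
        + ((1 - 2 * (I * α)) * (f 1 1 * conj (f 1 1)) - 2 * f 1 1 * f 2 0) * ω ^ 6
        + ((1 - 3 * (I * α)) * (f 1 1 * conj (f 1 1))
            + (2 - 6 * (I * α)) * (f 0 2 * conj (f 0 2)) - f 1 1 * f 2 0 * (1 - I * α)) * ω ^ 5
        + ((-1 - 2 * (I * α)) * (f 1 1 * conj (f 1 1)) - (1 - 2 * (I * α)) * f 2 0 * f 1 1
            - 2 * f 2 1) * ω ^ 4
        + (3 * f 1 1 * f 2 0 - f 1 1 * conj (f 1 1)) * (1 + I * α) * ω ^ 3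
        + (-(f 1 1 * conj (f 1 1)) - 2 * (f 0 2 * conj (f 0 2))
            + (1 + 2 * (I * α)) * f 1 1 * f 2 0) * ω ^ 2
        + (f 2 0 * f 1 1 * (1 + I * α) + f 2 1) * ω - f 1 1 * f 2 0)
      / (ω ^ 2 * (ω ^ 3 - 1) ^ 2) := by
  simp only [fieldCoeff, ← Complex.mul_conj']
  congr 1
  linear_combination -(
    (f 1 1 * conj (f 1 1) + f 2 1) * ω ^ 7
      + (f 1 1 * conj (f 1 1) - 2 * f 1 1 * f 2 0) * ω ^ 6
      + (f 1 1 * conj (f 1 1) + 2 * (f 0 2 * conj (f 0 2)) - f 1 1 * f 2 0) * ω ^ 5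
      + (-(f 1 1 * conj (f 1 1)) - f 2 0 * f 1 1 - 2 * f 2 1) * ω ^ 4
      + (3 * f 1 1 * f 2 0 - f 1 1 * conj (f 1 1)) * ω ^ 3
      + (-(f 1 1 * conj (f 1 1)) - 2 * (f 0 2 * conj (f 0 2)) + f 1 1 * f 2 0) * ω ^ 2
      + (f 2 0 * f 1 1 + f 2 1) * ω - f 1 1 * f 2 0) * Complex.I_mul_I

/-- Used with `x = y` an affine equation in the unknown `a`, of slope `l` and solution `b`. -/
lemma eq_iff_eq_of_sub_eq_mul {x y a b l : ℂ} (hl : l ≠ 0) (h : x - y = l * (a - b)) :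
    x = y ↔ a = b := by
  rw [← sub_eq_zero, h, mul_eq_zero, or_iff_right hl, sub_eq_zero]

lemma coeffEq_flowCoeff_iff {α : ℝ} (hα : α ≠ 0) {ω : ℂ} (hω : ω = Complex.exp (I * α))
    (hω2 : ω ^ 2 ≠ 1) (hω3 : ω ^ 3 ≠ 1) (hω4 : ω ^ 4 ≠ 1) (a f : ℕ → ℕ → ℂ) :
    CoeffEq (fun j k => ω * flowCoeff α a 1 j k) f ↔ CoeffEq a (fieldCoeff α ω f) := by
  have h0 : ω ≠ 0 := hω ▸ Complex.exp_ne_zero _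
  have hconj : conj ω = ω⁻¹ := by
    rw [hω, ← Complex.exp_neg, ← Complex.exp_conj]
    simp
  have h1 : ω - 1 ≠ 0 := fun h => hω2 (by linear_combination (ω + 1) * h)
  have hp1 : ω + 1 ≠ 0 := fun h => hω2 (by linear_combination (ω - 1) * h)
  have hp2 : ω ^ 2 + 1 ≠ 0 := fun h => hω4 (by linear_combination (ω ^ 2 - 1) * h)
  have h3 : ω ^ 2 + ω + 1 ≠ 0 := fun h => hω3 (by linear_combination (ω - 1) * h)
  have h3' : ω * (ω + 1) + 1 ≠ 0 := fun h => h3 (by linear_combination h)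
  have hs : I * (α : ℂ) ≠ 0 := mul_ne_zero Complex.I_ne_zero (by exact_mod_cast hα)
  have hsc : conj (I * (α : ℂ)) = -(I * α) := by simp
  have f3 : ω ^ 3 - 1 = (ω - 1) * (ω ^ 2 + ω + 1) := by ring
  have e20 : fieldCoeff α ω f 2 0 = I * α * f 2 0 / (ω * (ω - 1)) := rfl
  have e11 : fieldCoeff α ω f 1 1 = I * α * f 1 1 / (ω - 1) := rfl
  have e02 : fieldCoeff α ω f 0 2 = 3 * (I * α) * ω ^ 2 * f 0 2 / (ω ^ 3 - 1) := by
    simp only [fieldCoeff, mul_assoc]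
  have e30 : fieldCoeff α ω f 3 0 = -(I * α) *
        ((conj (f 0 2) * f 1 1 - 2 * f 3 0) * ω ^ 3
          + 2 * (conj (f 0 2) * f 1 1 + f 2 0 ^ 2 - f 3 0) * ω ^ 2
          + 2 * (f 2 0 ^ 2 - f 3 0) * ω
          + 2 * f 2 0 ^ 2)
        / (ω ^ 2 * (ω ^ 3 - 1) * (ω + 1)) := by
    simp only [fieldCoeff, neg_mul]
  have e21 := fieldCoeff_two_one α ω f
  have e12 : fieldCoeff α ω f 1 2 = -(I * α) *
        (f 1 1 * conj (f 2 0) * ω ^ 4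
          + (2 * conj (f 1 1) * f 0 2 + conj (f 2 0) * f 1 1 - 2 * f 1 2) * ω ^ 3
          + (4 * conj (f 1 1) * f 0 2 + conj (f 2 0) * f 1 1 + 4 * f 0 2 * f 2 0
              + f 1 1 ^ 2 - 2 * f 1 2) * ω ^ 2
          + (2 * f 0 2 * f 2 0 + f 1 1 ^ 2 - 2 * f 1 2) * ω
          + f 1 1 ^ 2)
        / ((ω ^ 3 - 1) * (ω + 1)) := by
    simp only [fieldCoeff, neg_mul]
  have e03 : fieldCoeff α ω f 0 3 = -(I * α) * ω ^ 2 *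
        (2 * f 0 2 * conj (f 2 0) * ω ^ 4
          + 4 * (f 0 2 * conj (f 2 0) - f 0 3) * ω ^ 3
          + (6 * f 0 2 * conj (f 2 0) + 3 * f 0 2 * f 1 1 - 4 * f 0 3) * ω ^ 2
          + 2 * (f 0 2 * f 1 1 - 2 * f 0 3) * ω
          + f 0 2 * f 1 1)
        / ((ω ^ 2 + 1) * (ω ^ 3 - 1) * (ω + 1)) := by
    simp only [fieldCoeff, neg_mul]
  simp only [CoeffEq, e20, e11, e02, e30, e21, e12, e03]
  simp only [flowCoeff, phase_one, ← hω, Complex.ofReal_one]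
  -- Only `s ≠ 0` and `conj s = -s` matter from here on.
  generalize I * (α : ℂ) = s at hs hsc
  simp only [zpow_neg, zpow_ofNat, pow_one, Int.cast_neg, Int.cast_one, Int.cast_ofNat, f3]
  have hquad20 : ω * (a 2 0 * ((ω - 1) / (1 * s))) = f 2 0 ↔
      a 2 0 = s * f 2 0 / (ω * (ω - 1)) :=
    eq_iff_eq_of_sub_eq_mul (l := ω * (ω - 1) / s) (by simp [h0, h1, hs]) (by field_simp)
  have hquad11 : ω * (a 1 1 * ((ω⁻¹ - 1) / (-1 * s))) = f 1 1 ↔ a 1 1 = s * f 1 1 / (ω - 1) :=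
    eq_iff_eq_of_sub_eq_mul (l := (ω - 1) / s) (by simp [h1, hs]) (by field_simp; ring)
  have hquad02 : ω * (a 0 2 * (((ω ^ 3)⁻¹ - 1) / (-3 * s))) = f 0 2 ↔
      a 0 2 = 3 * s * ω ^ 2 * f 0 2 / ((ω - 1) * (ω ^ 2 + ω + 1)) :=
    eq_iff_eq_of_sub_eq_mul (l := (ω - 1) * (ω ^ 2 + ω + 1) / (3 * s * ω ^ 2))
      (by simp [h0, h1, h3, hs])
      (by field_simp; ring)
  rw [hquad20, hquad11, hquad02]
  refine and_congr_right fun ⟨h20, h11, h02⟩ => ?_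
  -- The cubic equations involve conjugates of the quadratic coefficients; `conj ω = ω⁻¹` makes
  -- these rational in `ω`.
  have hinv : conj (ω - 1) = -(ω - 1) / ω := by
    rw [map_sub, map_one, hconj]
    field_simp
    ring
  have hinv3 : conj (ω ^ 2 + ω + 1) = (ω ^ 2 + ω + 1) / ω ^ 2 := by
    rw [map_add, map_add, map_pow, map_one, hconj]
    field_simp
    ring
  have c20 : conj (a 2 0) = s * conj (f 2 0) * ω ^ 2 / (ω - 1) := by
    rw [h20, map_div₀, map_mul, map_mul, hsc, hinv, hconj]
    field_simp
  have c11 : conj (a 1 1) = s * conj (f 1 1) * ω / (ω - 1) := by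
    rw [h11, map_div₀, map_mul, hsc, hinv]
    field_simp
  have c02 : conj (a 0 2) = 3 * s * ω * conj (f 0 2) / ((ω - 1) * (ω ^ 2 + ω + 1)) := by
    rw [h02, map_div₀, map_mul, map_mul, map_mul, map_mul, hsc, hinv, hinv3, map_pow, hconj,
      map_ofNat]
    field_simp
  rw [c20, c11, c02, h20, h11, h02]
  -- The slopes are `ω * phase α n 1` for `n = 2, -2, -4`, and `ω` itself in the resonant case.
  refine and_congr ?_ (and_congr ?_ (and_congr ?_ ?_))
  · exact eq_iff_eq_of_sub_eq_mul (l := ω * ((ω - 1) * (ω + 1)) / (2 * s)) (by simp [h0, h1, hp1, hs])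
      (by field_simp; ring)
  · exact eq_iff_eq_of_sub_eq_mul (l := ω) h0 (by field_simp; ring)
  · exact eq_iff_eq_of_sub_eq_mul (l := (ω - 1) * (ω + 1) / (2 * s * ω)) (by simp [h0, h1, hp1, hs])
      (by field_simp; ring)
  · exact eq_iff_eq_of_sub_eq_mul (l := (ω - 1) * (ω + 1) * (ω ^ 2 + 1) / (4 * s * ω ^ 3))
      (by simp [h0, h1, hp1, hp2, hs]) (by field_simp; ring)

lemma timeOneMapAgrees_iff_coeffEq {α : ℝ} (hα : α ≠ 0) {ω : ℂ} (hω : ω = Complex.exp (I * α))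
    (hω2 : ω ^ 2 ≠ 1) (hω3 : ω ^ 3 ≠ 1) (hω4 : ω ^ 4 ≠ 1) (a f : ℕ → ℕ → ℂ) :
    TimeOneMapAgrees 3 (planarPoly 3 (I * α) a) (planarPoly 3 ω f) ↔
      CoeffEq a (fieldCoeff α ω f) := by
  rw [timeOneMapAgrees_iff_isBigO hα, ← hω, ← coeffEq_flowCoeff_iff hα hω hω2 hω3 hω4]
  have h : ∀ z, ω * planarPoly 3 1 (flowCoeff α a 1) z
      = planarPoly 3 ω (fun j k => ω * flowCoeff α a 1 j k) z := fun z => by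
    simp only [planarPoly_three, quadForm, cubicForm]
    ring
  simp only [h]
  refine ⟨coeffEq_of_isBigO, fun hc => ?_⟩
  simp only [hc.planarPoly_eq, sub_self]
  exact isBigO_zero _ _

theorem propositionp (α : ℝ) (hα : α ∈ Set.Ioo 0 (2 * Real.pi)) (ω : ℂ)
    (hω : ω = Complex.exp (I * α))
    (hω2 : ω ^ 2 ≠ 1) (hω3 : ω ^ 3 ≠ 1) (hω4 : ω ^ 4 ≠ 1) (f : ℕ → ℕ → ℂ) :
    (∃! X : ℂ → ℂ, IsPolyField 3 α X ∧ TimeOneMapAgrees 3 X (planarPoly 3 ω f)) ∧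
    ∀ a : ℕ → ℕ → ℂ, TimeOneMapAgrees 3 (planarPoly 3 (I * α) a) (planarPoly 3 ω f) →
      a 2 0 = I * α * f 2 0 / (ω * (ω - 1)) ∧
      a 1 1 = I * α * f 1 1 / (ω - 1) ∧
      a 0 2 = 3 * I * α * ω ^ 2 * f 0 2 / (ω ^ 3 - 1) ∧
      a 3 0 = -I * α *
        ((conj (f 0 2) * f 1 1 - 2 * f 3 0) * ω ^ 3
          + 2 * (conj (f 0 2) * f 1 1 + f 2 0 ^ 2 - f 3 0) * ω ^ 2
          + 2 * (f 2 0 ^ 2 - f 3 0) * ω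
          + 2 * f 2 0 ^ 2)
        / (ω ^ 2 * (ω ^ 3 - 1) * (ω + 1)) ∧
      a 2 1 = -I *
        (((I + α) * (‖f 1 1‖ : ℂ) ^ 2 + I * f 2 1) * ω ^ 7
          + ((I + 2 * α) * (‖f 1 1‖ : ℂ) ^ 2 - 2 * I * f 1 1 * f 2 0) * ω ^ 6
          + ((I + 3 * α) * (‖f 1 1‖ : ℂ) ^ 2 + (2 * I + 6 * α) * (‖f 0 2‖ : ℂ) ^ 2
              - f 1 1 * f 2 0 * (I + α)) * ω ^ 5
          + ((-I + 2 * α) * (‖f 1 1‖ : ℂ) ^ 2 - (I + 2 * α) * f 2 0 * f 1 1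
              - 2 * I * f 2 1) * ω ^ 4
          + (3 * f 1 1 * f 2 0 - (‖f 1 1‖ : ℂ) ^ 2) * (I - α) * ω ^ 3
          + (-I * (‖f 1 1‖ : ℂ) ^ 2 - 2 * I * (‖f 0 2‖ : ℂ) ^ 2
              + (I - 2 * α) * f 1 1 * f 2 0) * ω ^ 2
          + (f 2 0 * f 1 1 * (I - α) + I * f 2 1) * ω
          - I * f 1 1 * f 2 0)
        / (ω ^ 2 * (ω ^ 3 - 1) ^ 2) ∧
      a 1 2 = -I * α *
        (f 1 1 * conj (f 2 0) * ω ^ 4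
          + (2 * conj (f 1 1) * f 0 2 + conj (f 2 0) * f 1 1 - 2 * f 1 2) * ω ^ 3
          + (4 * conj (f 1 1) * f 0 2 + conj (f 2 0) * f 1 1 + 4 * f 0 2 * f 2 0
              + f 1 1 ^ 2 - 2 * f 1 2) * ω ^ 2
          + (2 * f 0 2 * f 2 0 + f 1 1 ^ 2 - 2 * f 1 2) * ω
          + f 1 1 ^ 2)
        / ((ω ^ 3 - 1) * (ω + 1)) ∧
      a 0 3 = -I * α * ω ^ 2 *
        (2 * f 0 2 * conj (f 2 0) * ω ^ 4
          + 4 * (f 0 2 * conj (f 2 0) - f 0 3) * ω ^ 3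
          + (6 * f 0 2 * conj (f 2 0) + 3 * f 0 2 * f 1 1 - 4 * f 0 3) * ω ^ 2
          + 2 * (f 0 2 * f 1 1 - 2 * f 0 3) * ω
          + f 0 2 * f 1 1)
        / ((ω ^ 2 + 1) * (ω ^ 3 - 1) * (ω + 1)) := by
  have hα0 : α ≠ 0 := hα.1.ne'
  have key := timeOneMapAgrees_iff_coeffEq hα0 hω hω2 hω3 hω4
  refine ⟨⟨planarPoly 3 (I * α) (fieldCoeff α ω f), ⟨⟨_, rfl⟩, (key _ f).2 ?_⟩, ?_⟩, ?_⟩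
  · exact ⟨⟨rfl, rfl, rfl⟩, rfl, rfl, rfl, rfl⟩
  · rintro _ ⟨⟨a, rfl⟩, h⟩
    exact ((key a f).1 h).planarPoly_eq _
  · intro a h
    obtain ⟨⟨h20, h11, h02⟩, h30, h21, h12, h03⟩ := (key a f).1 h
    exact ⟨h20, h11, h02, h30, h21, h12, h03⟩
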